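/- For a monic polynomial $g(x)\in\mathbb{Z}[x]$ that is irreducible over $\mathbb{Q}$, with a root $\theta$ and $K=\mathbb{Q}(\theta)$, the index of $g$ is $[\mathbb{Z}_K:\mathbb{Z}[\theta]]$, where $\mathbb{Z}_K$ is the ring of algebraic integers of $K$; $g$ is called monogenic if its index is $1$. For a nonzero integer $z$, $\operatorname{rad}(z)$ denotes the largest squarefree positive integer dividing $z$. Let $A$ and $B$ be integers and let $d$ and $m$ be positive integers with $d>m$ and $\gcd(d,mB)=1$. Let $f(x)=x^d+A(Bx+1)^m$ and let $k$ be a positive integer such that $f(x^k)$ is irreducible over $\mathbb{Q}$. Then $f(x^k)$ is monogenic if and only if the following two statements hold: 1. Both $A$ and $d^d+(-1)^{d+m}B^dm^m(d-m)^{d-m}A$ are squarefree. 2. For every prime $p$ dividing $k$, the polynomial $$\frac{1}{p}\Big[\big(-A(Bx+1)^m\big)^p+A(Bx^p+1)^m\Big]$$ has integer coefficients and is coprime to $f(x)$ modulo $p$, that is, the reductions of the two polynomials are coprime in $(\mathbb{Z}/p\mathbb{Z})[x]$. Furthermore, if $\operatorname{rad}(k)\mid\operatorname{rad}(A)$, then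 $f(x^k)$ is monogenic if and only if both $A$ and $d^d+(-1)^{d+m}B^dm^m(d-m)^{d-m}A$ are squarefree. -/

import Mathlib

open Polynomial

/-- The algebra `K = ℚ[x]/(f)` attached to an integer polynomial `f`. When `f` is irreducible over
`ℚ`, this is the number field `ℚ(θ)` generated by a root `θ` of `f`. -/
abbrev RootField (f : ℤ[X]) : Type :=
  AdjoinRoot (f.map (algebraMap ℤ ℚ))

/-- The distinguished root `θ` of `f` in `RootField f`. -/
noncomputable def rootOf (f : ℤ[X]) : RootField f :=
  AdjoinRoot.root (f.map (algebraMap ℤ ℚ))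

/-- The index `[ℤ_K : ℤ[θ]]` of `f`, where `K = ℚ(θ)`, `θ` is a root of `f`, and `ℤ_K` is the ring of
elements of `K` that are integral over `ℤ`. It is the index of additive groups (with the value `0`
for an infinite index); for monic `f`, `ℤ[θ]` is contained in `ℤ_K`. -/
noncomputable def polyIndex (f : ℤ[X]) : ℕ :=
  (Algebra.adjoin ℤ {rootOf f}).toSubring.toAddSubgroup.relIndex
    (integralClosure ℤ (RootField f)).toSubring.toAddSubgroup

/-- A polynomial with integer coefficients is monogenic if it is monic, irreducible over `ℚ`, and
its index equals `1`. -/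
def IsMonogenicPoly (f : ℤ[X]) : Prop :=
  f.Monic ∧ Irreducible (f.map (algebraMap ℤ ℚ)) ∧ polyIndex f = 1

/-- The polynomial `f(x) = x ^ d + A (B x + 1) ^ m`. -/
noncomputable def familyPoly (A B : ℤ) (d m : ℕ) : ℤ[X] :=
  X ^ d + C A * (C B * X + 1) ^ m

/-- The polynomial `(1/p) g` has integer coefficients, and it is coprime to `f` modulo `p`, that is,
the reductions of both to polynomials over `ℤ/pℤ` are coprime. Here `q` is `(1/p) g`, which for
`p ≠ 0` is determined by `p q = g`. -/
def DivCoprimeMod (p : ℕ) (g f : ℤ[X]) : Prop :=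
  ∃ q : ℤ[X], C (p : ℤ) * q = g ∧
    IsCoprime (q.map (Int.castRingHom (ZMod p))) (f.map (Int.castRingHom (ZMod p)))

/-! By Uchida's form of Dedekind's criterion (`polyIndex_eq_one_iff`), a monic irreducible `g` is
monogenic iff it lies in no `M ^ 2`, where `M = (p, φ)` with `φ` irreducible mod `p`. Each prime can
then be tested separately for `g = f(x^k)`.

If `p ∣ A`, then `g ≡ x^(kd)` mod `p`, and the test at `(p, x)` is `p² ∤ A`
(`regularAt_familyPoly_of_dvd_coeff`). If `p ∣ k`, then `g` is a `p`-th power mod `p`, and its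
second-order expansion turns the test into the coprimality condition
(`regularAt_familyPoly_of_dvd_exponent`). If `p` divides neither, a double root of `f` mod `p` must
be the root `b` of `(d - m)Bx + d`. Taken mod `p²`, this `b` makes `f(b)` equal to the discriminant
factor up to a unit, so the test is that `p²` does not divide that factor
(`regularAt_of_not_sq_dvd_discFactor`).

When `rad k ∣ rad A`, every `p ∣ k` also divides `A`. The first two tests are then equivalent, and
the second condition follows from `A` being squarefree. -/

/-- The ideal `(p, φ)` of `ℤ[X]`; it is maximal when `φ` is irreducible modulo the prime `p`. -/
noncomputable abbrev pointIdeal (p : ℕ) (φ : ℤ[X]) : Ideal ℤ[X] :=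
  Ideal.span {C (p : ℤ), φ}

/-- Reduction of integer polynomials modulo `p`. -/
noncomputable abbrev modP (p : ℕ) : ℤ[X] →+* (ZMod p)[X] :=
  mapRingHom (Int.castRingHom (ZMod p))

/-- `g` does not lie in the square of any maximal ideal of `ℤ[X]` above `p`. -/
def RegularAt (p : ℕ) (g : ℤ[X]) : Prop :=
  ∀ φ : ℤ[X], Irreducible (modP p φ) → g ∉ pointIdeal p φ ^ 2

/-! ### Maximal ideals of `ℤ[X]` above `p` and their squares. -/

section PointIdeal

variable {p : ℕ} {φ : ℤ[X]}

theorem modP_surjective (p : ℕ) : Function.Surjective (modP p) :=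
  map_surjective _ (ZMod.intCast_surjective)

theorem modP_eq_zero_iff (h : ℤ[X]) : modP p h = 0 ↔ ∃ r, h = C (p : ℤ) * r := by
  constructor
  · intro hh
    have : C (p : ℤ) ∣ h := by
      rw [C_dvd_iff_dvd_coeff]
      intro i
      have := congrArg (fun q => coeff q i) hh
      simp only [coe_mapRingHom, coeff_map, eq_intCast, coeff_zero] at this
      exact (ZMod.intCast_zmod_eq_zero_iff_dvd _ _).1 this
    exact this
  · rintro ⟨r, rfl⟩
    simp

theorem modP_eq_iff (h h' : ℤ[X]) : modP p h = modP p h' ↔ ∃ r, h = h' + C (p : ℤ) * r := by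
  rw [← sub_eq_zero, ← map_sub, modP_eq_zero_iff]
  exact exists_congr fun r => by rw [sub_eq_iff_eq_add']

theorem mem_pointIdeal_iff (h : ℤ[X]) : h ∈ pointIdeal p φ ↔ modP p φ ∣ modP p h := by
  rw [Ideal.mem_span_pair]
  constructor
  · rintro ⟨a, b, rfl⟩
    simp
  · rintro ⟨c, hc⟩
    obtain ⟨c, rfl⟩ := modP_surjective p c
    rw [← map_mul, modP_eq_iff] at hc
    obtain ⟨r, rfl⟩ := hc
    exact ⟨r, c, by ring⟩

theorem C_mem_pointIdeal : C (p : ℤ) ∈ pointIdeal p φ := Ideal.subset_span (by simp)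

theorem self_mem_pointIdeal : φ ∈ pointIdeal p φ := Ideal.subset_span (by simp)

theorem mem_pointIdeal_sq_iff (h : ℤ[X]) : h ∈ pointIdeal p φ ^ 2 ↔
    ∃ a b c, h = C (p : ℤ) ^ 2 * a + C (p : ℤ) * φ * b + φ ^ 2 * c := by
  rw [pow_two, Ideal.span_pair_mul_span_pair]
  simp only [Ideal.mem_span_insert, Ideal.mem_span_singleton']
  constructor
  · rintro ⟨a, _, ⟨b, _, ⟨b', _, ⟨c, rfl⟩, rfl⟩, rfl⟩, rfl⟩
    exact ⟨a, b + b', c, by ring⟩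
  · rintro ⟨a, b, c, rfl⟩
    exact ⟨a, _, ⟨b, _, ⟨0, _, ⟨c, rfl⟩, rfl⟩, rfl⟩, by ring⟩

theorem derivative_mem_pointIdeal {h : ℤ[X]} (hh : h ∈ pointIdeal p φ ^ 2) :
    derivative h ∈ pointIdeal p φ := by
  obtain ⟨a, b, c, rfl⟩ := (mem_pointIdeal_sq_iff _).1 hh
  rw [Ideal.mem_span_pair]
  refine ⟨C (p : ℤ) * derivative a + derivative φ * b + φ * derivative b,
    2 * derivative φ * c + φ * derivative c, ?_⟩
  simp [derivative_pow]
  ring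

variable [hp : Fact p.Prime] (hφ : Irreducible (modP p φ))
include hφ

theorem pointIdeal_isPrime : (pointIdeal p φ).IsPrime := by
  refine ⟨?_, ?_⟩
  · rw [Ideal.ne_top_iff_one, mem_pointIdeal_iff, map_one]
    exact fun h => hφ.not_isUnit (isUnit_of_dvd_one h)
  · intro x y
    simp only [mem_pointIdeal_iff, map_mul]
    exact hφ.prime.dvd_or_dvd

theorem C_mem_pointIdeal_iff (n : ℤ) : C n ∈ pointIdeal p φ ↔ (p : ℤ) ∣ n := by
  constructor
  · intro h
    by_contra hn
    obtain ⟨u, v, huv⟩ := ((Nat.prime_iff_prime_int.1 hp.out).coprime_iff_not_dvd).2 hn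
    refine (pointIdeal_isPrime hφ).ne_top ((Ideal.eq_top_iff_one _).2 ?_)
    have : (1 : ℤ[X]) = C u * C (p : ℤ) + C v * C n := by
      rw [← C_mul, ← C_mul, ← C_add, huv, C_1]
    rw [this]
    exact add_mem (Ideal.mul_mem_left _ _ C_mem_pointIdeal) (Ideal.mul_mem_left _ _ h)
  · rintro ⟨r, rfl⟩
    rw [C_mul]
    exact Ideal.mul_mem_right _ _ C_mem_pointIdeal

/-- In `p r = p² a + p φ b + φ² c`, reduction mod `p` forces `p ∣ c`, so one factor `p` cancels
throughout. -/
theorem C_mul_mem_pointIdeal_sq_iff (r : ℤ[X]) :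
    C (p : ℤ) * r ∈ pointIdeal p φ ^ 2 ↔ r ∈ pointIdeal p φ := by
  constructor
  · intro h
    obtain ⟨a, b, c, h⟩ := (mem_pointIdeal_sq_iff _).1 h
    have h0 : modP p φ ^ 2 * modP p c = 0 := by
      have := congrArg (modP p) h
      simpa using this.symm
    have hc : modP p c = 0 := (mul_eq_zero.1 h0).resolve_left (pow_ne_zero _ hφ.ne_zero)
    obtain ⟨c, rfl⟩ := (modP_eq_zero_iff _).1 hc
    have hp0 : (C (p : ℤ) : ℤ[X]) ≠ 0 := by simpa using hp.out.ne_zero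
    have : r = (C (p : ℤ) * a) + φ * (b + φ * c) := mul_left_cancel₀ hp0 (by rw [h]; ring)
    rw [this]
    exact add_mem (Ideal.mul_mem_right _ _ C_mem_pointIdeal)
      (Ideal.mul_mem_right _ _ self_mem_pointIdeal)
  · intro h
    rw [pow_two]
    exact Ideal.mul_mem_mul C_mem_pointIdeal h

theorem C_mem_pointIdeal_sq_iff (n : ℤ) : C n ∈ pointIdeal p φ ^ 2 ↔ (p : ℤ) * p ∣ n := by
  have key (r : ℤ) : C ((p : ℤ) * r) ∈ pointIdeal p φ ^ 2 ↔ (p : ℤ) ∣ r := by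
    rw [C_mul, C_mul_mem_pointIdeal_sq_iff hφ, C_mem_pointIdeal_iff hφ]
  constructor
  · intro h
    obtain ⟨r, rfl⟩ := (C_mem_pointIdeal_iff hφ n).1 (Ideal.pow_le_self two_ne_zero h)
    exact mul_dvd_mul_left _ ((key r).1 h)
  · rintro ⟨r, rfl⟩
    rw [mul_assoc, key]
    exact dvd_mul_right _ _

end PointIdeal

/-- A non-unit of `𝔽_p[X]` lies below some point. -/
theorem exists_irreducible_modP_dvd {p : ℕ} [Fact p.Prime] {h : (ZMod p)[X]} (h0 : h ≠ 0)
    (hu : ¬ IsUnit h) : ∃ φ : ℤ[X], Irreducible (modP p φ) ∧ modP p φ ∣ h := by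
  obtain ⟨φ, hφ, hd⟩ := WfDvdMonoid.exists_irreducible_factor hu h0
  obtain ⟨φ, rfl⟩ := modP_surjective p φ
  exact ⟨φ, hφ, hd⟩

/-! ### Dedekind's criterion in Uchida's form. -/

section Criterion

theorem IsIntegral.aeval_of_int {A : Type*} [CommRing A] {x : A} (hx : IsIntegral ℤ x)
    (q : ℤ[X]) : IsIntegral ℤ (aeval x q) :=
  IsIntegral.of_mem_of_fg _ hx.fg_adjoin_singleton _ (aeval_mem_adjoin_singleton ℤ x)

variable {K : Type*} [Field K] {θ : K} {g : ℤ[X]}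

theorem isIntegral_of_aeval_eq_zero_iff (hroot : ∀ h : ℤ[X], aeval θ h = 0 ↔ g ∣ h)
    (hg : g.Monic) : IsIntegral ℤ θ :=
  ⟨g, hg, by simpa [aeval_def] using (hroot g).2 dvd_rfl⟩

/-- If `b(θ) = ζ a(θ)` with `ζ` integral, every prime containing `g` and `a` contains `b`. -/
theorem mem_of_aeval_eq_integral_mul (hroot : ∀ h : ℤ[X], aeval θ h = 0 ↔ g ∣ h)
    {M : Ideal ℤ[X]} [M.IsPrime] (hgM : g ∈ M) {a b : ℤ[X]} (ha : a ∈ M) {ζ : K}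
    (hζ : IsIntegral ℤ ζ) (hb : aeval θ b = ζ * aeval θ a) : b ∈ M := by
  obtain ⟨P, hP, hPζ⟩ := hζ
  set n := P.natDegree with hn
  -- The homogenised integral equation of `ζ`: it vanishes at `θ`, and every term except `b ^ n`
  -- contains a factor `a`.
  set T : ℤ[X] := ∑ i ∈ Finset.range (n + 1), C (P.coeff i) * a ^ (n - i) * b ^ i with hT
  have hT0 : aeval θ T = 0 := by
    have h1 : aeval θ T = aeval θ a ^ n * eval₂ (algebraMap ℤ K) ζ P := by
      rw [hT, map_sum, eval₂_eq_sum_range, Finset.mul_sum]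
      refine Finset.sum_congr rfl fun i hi => ?_
      have hi : i ≤ n := Nat.lt_succ_iff.1 (Finset.mem_range.1 hi)
      rw [map_mul, map_mul, map_pow, map_pow, hb, aeval_C, mul_pow]
      conv_rhs => rw [← Nat.sub_add_cancel hi, pow_add]
      ring
    rw [h1, hPζ, mul_zero]
  have hTM : T ∈ M := Ideal.mem_of_dvd _ ((hroot T).1 hT0) hgM
  rw [hT, Finset.sum_range_succ] at hTM
  have hlow : ∑ i ∈ Finset.range n, C (P.coeff i) * a ^ (n - i) * b ^ i ∈ M := by
    refine Ideal.sum_mem _ fun i hi => ?_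
    have hi : i < n := Finset.mem_range.1 hi
    exact Ideal.mul_mem_right _ _ (Ideal.mul_mem_left _ _
      (Ideal.pow_mem_of_mem _ ha _ (Nat.sub_pos_of_lt hi)))
  have hbn := (Ideal.add_mem_iff_right M hlow).1 hTM
  have h1 : P.coeff n = 1 := hP.coeff_natDegree
  rw [h1, Nat.sub_self, pow_zero, C_1, one_mul, one_mul] at hbn
  exact Ideal.IsPrime.mem_of_pow_mem inferInstance _ hbn

variable [CharZero K]

/-- The polynomials `q` with `q(θ)/p` integral form an ideal `J` containing `g`. Its reduction mod
`p` is generated by some `u`, so `g ≡ u v`. If `v` is a unit, `g` divides `h` mod `p` and `ζ` is a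
polynomial in `θ`. Otherwise an irreducible factor `φ` of `v` gives `g = φ ψ - p r` with `ψ ∈ J`;
integrality puts both `ψ` and `r` in `(p, φ)`, contradicting regularity. -/
theorem exists_aeval_eq_of_prime_mul {p : ℕ} [hp : Fact p.Prime]
    (hroot : ∀ h : ℤ[X], aeval θ h = 0 ↔ g ∣ h) (hg : g.Monic) (hreg : RegularAt p g) {ζ : K}
    (hζ : IsIntegral ℤ ζ) {h : ℤ[X]} (hh : (p : K) * ζ = aeval θ h) :
    ∃ h' : ℤ[X], ζ = aeval θ h' := by
  have hp0 : (p : K) ≠ 0 := Nat.cast_ne_zero.2 hp.out.ne_zero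
  have hpoly := (isIntegral_of_aeval_eq_zero_iff hroot hg).aeval_of_int
  by_contra hne
  let J : Ideal ℤ[X] :=
    { carrier := {q | IsIntegral ℤ (aeval θ q / p)}
      add_mem' := fun {a b} ha hb => by
        simp only [Set.mem_ofPred_eq, map_add, add_div] at *
        exact ha.add hb
      zero_mem' := by simpa using isIntegral_zero
      smul_mem' := fun c q hq => by
        simp only [Set.mem_ofPred_eq, smul_eq_mul, map_mul, mul_div_assoc] at *
        exact (hpoly c).mul hq }
  have hJ (q : ℤ[X]) : q ∈ J ↔ IsIntegral ℤ (aeval θ q / p) := Iff.rfl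
  have hhJ : h ∈ J := by
    rw [hJ, ← hh, mul_div_cancel_left₀ _ hp0]
    exact hζ
  have hgJ : g ∈ J := by
    rw [hJ, (hroot g).2 dvd_rfl, zero_div]
    exact isIntegral_zero
  obtain ⟨u, hu⟩ := IsPrincipalIdealRing.principal (J.map (modP p))
  have hmem (q : ℤ[X]) (hq : q ∈ J) : u ∣ modP p q := by
    rw [← Ideal.mem_span_singleton]
    have := Ideal.mem_map_of_mem (modP p) hq
    rwa [hu] at this
  have hg0 : modP p g ≠ 0 := (hg.map _).ne_zero
  obtain ⟨v, hv⟩ := hmem g hgJ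
  have hvu : ¬ IsUnit v := by
    intro hvu
    have hdvd : modP p g ∣ modP p h := by
      rw [hv]
      exact (hvu.mul_right_dvd).2 (hmem h hhJ)
    obtain ⟨s, hs⟩ := hdvd
    obtain ⟨s, rfl⟩ := modP_surjective p s
    rw [← map_mul, modP_eq_iff] at hs
    obtain ⟨r, rfl⟩ := hs
    refine hne ⟨r, mul_left_cancel₀ hp0 ?_⟩
    rw [hh]
    simp [(hroot g).2 dvd_rfl]
  have hv0 : v ≠ 0 := by
    rintro rfl
    exact hg0 (by rw [hv, mul_zero])
  obtain ⟨φ, hφ, w, hw⟩ := exists_irreducible_modP_dvd hv0 hvu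
  have hψ : u * w ∈ J.map (modP p) := by
    rw [hu]
    exact Ideal.mem_span_singleton.2 (dvd_mul_right _ _)
  obtain ⟨ψ, hψJ, hψ⟩ := (Ideal.mem_map_iff_of_surjective _ (modP_surjective p)).1 hψ
  have hprod : modP p (φ * ψ) = modP p g := by
    rw [map_mul, hψ, hv, hw]
    ring
  obtain ⟨r, hr⟩ := (modP_eq_iff _ _).1 hprod
  have hprime := pointIdeal_isPrime hφ
  have hgM : g ∈ pointIdeal p φ := by
    rw [mem_pointIdeal_iff, ← hprod, map_mul]
    exact dvd_mul_right _ _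
  have hψM : ψ ∈ pointIdeal p φ :=
    mem_of_aeval_eq_integral_mul hroot hgM C_mem_pointIdeal hψJ (by simp [hp0])
  have hrM : r ∈ pointIdeal p φ := by
    refine mem_of_aeval_eq_integral_mul hroot hgM self_mem_pointIdeal hψJ ?_
    have := congrArg (aeval θ) hr
    simp only [map_mul, map_add, (hroot g).2 dvd_rfl, zero_add, aeval_C] at this
    field_simp
    rw [mul_comm (aeval θ ψ), this]
    simp [mul_comm]
  refine hreg φ hφ ?_
  have : g = φ * ψ - C (p : ℤ) * r := by rw [hr]; ring
  rw [this, pow_two]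
  exact sub_mem (Ideal.mul_mem_mul self_mem_pointIdeal hψM)
    (Ideal.mul_mem_mul C_mem_pointIdeal hrM)

theorem exists_aeval_eq_of_nat_mul (hroot : ∀ h : ℤ[X], aeval θ h = 0 ↔ g ∣ h) (hg : g.Monic)
    (hreg : ∀ p : ℕ, p.Prime → RegularAt p g) (n : ℕ) : n ≠ 0 → ∀ {ζ : K}, IsIntegral ℤ ζ →
      ∀ h : ℤ[X], (n : K) * ζ = aeval θ h → ∃ h' : ℤ[X], ζ = aeval θ h' := by
  induction n using induction_on_primes with
  | zero => exact fun h => absurd rfl h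
  | one => exact fun _ ζ _ h hh => ⟨h, by simpa using hh⟩
  | prime_mul p a hp ih =>
    intro hpa ζ hζ h hh
    have := Fact.mk hp
    have hint : IsIntegral ℤ ((a : K) * ζ) := by
      simpa using (isIntegral_algebraMap (R := ℤ) (A := K) (x := (a : ℤ))).mul hζ
    obtain ⟨h', hh'⟩ := exists_aeval_eq_of_prime_mul hroot hg (hreg p hp) hint
      (h := h) (by rw [← hh]; push_cast; ring)
    exact ih (right_ne_zero_of_mul hpa) hζ h' hh'

/-- If `g = p² a + p φ b + φ² c`, then `ζ = φ(θ)c(θ)/p` is integral, being a root of `z² + b(θ) z +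
c(θ)a(θ)`. Were it a polynomial in `θ`, then `g ≡ φ · φc` would divide `φc` mod `p`, making `φ` a
unit. -/
theorem regularAt_of_forall_integral {p : ℕ} [hp : Fact p.Prime]
    (hroot : ∀ h : ℤ[X], aeval θ h = 0 ↔ g ∣ h) (hg : g.Monic)
    (hint : ∀ ζ : K, IsIntegral ℤ ζ → ∃ h : ℤ[X], ζ = aeval θ h) : RegularAt p g := by
  intro φ hφ hmem
  obtain ⟨a, b, c, habc⟩ := (mem_pointIdeal_sq_iff _).1 hmem
  have hp0 : (p : K) ≠ 0 := Nat.cast_ne_zero.2 hp.out.ne_zero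
  have hpoly := (isIntegral_of_aeval_eq_zero_iff hroot hg).aeval_of_int
  set ζ : K := aeval θ (φ * c) / p with hζ
  have h0 := (hroot g).2 dvd_rfl
  rw [habc] at h0
  simp only [map_add, map_mul, map_pow, map_natCast] at h0
  have hquad : ζ ^ 2 + aeval θ b * ζ + aeval θ (c * a) = 0 := by
    rw [hζ]
    simp only [map_mul]
    field_simp
    have : algebraMap ℤ K (p : ℤ) = p := by simp
    linear_combination (aeval θ c) * h0
  have hζi : IsIntegral ℤ ζ := by
    let R := integralClosure ℤ K
    refine isIntegral_trans (A := R) ζ ?_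
    let b' : R := ⟨aeval θ b, hpoly b⟩
    let e' : R := ⟨aeval θ (c * a), hpoly _⟩
    refine ⟨X ^ 2 + (C b' * X + C e'), ?_, ?_⟩
    · exact monic_X_pow_add (lt_of_le_of_lt degree_linear_le (by norm_num))
    · have hb : algebraMap R K b' = aeval θ b := rfl
      have he : algebraMap R K e' = aeval θ (c * a) := rfl
      simp only [eval₂_add, eval₂_pow, eval₂_mul, eval₂_X, eval₂_C, hb, he]
      rw [← hquad]
      ring
  obtain ⟨h, hh⟩ := hint ζ hζi
  have hdiv : g ∣ φ * c - C (p : ℤ) * h := by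
    rw [← hroot, map_sub, map_mul (aeval θ) (C _) h, ← hh, hζ, aeval_C]
    field_simp
    simp
  have hdiv' : modP p g ∣ modP p (φ * c) := by
    have := map_dvd (modP p) hdiv
    simpa using this
  have hg0 : modP p g ≠ 0 := (hg.map _).ne_zero
  have hgm : modP p g = modP p φ * modP p (φ * c) := by
    rw [habc]
    simp
    ring
  have hne : modP p (φ * c) ≠ 0 := right_ne_zero_of_mul (hgm ▸ hg0)
  obtain ⟨s, hs⟩ := hdiv'
  rw [hgm] at hs
  have h1 : modP p φ * s = 1 := mul_right_cancel₀ hne (by rw [one_mul]; conv_rhs => rw [hs]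
                                                          ring)
  exact hφ.not_isUnit (IsUnit.of_mul_eq_one _ h1)

end Criterion

theorem aeval_rootOf (g h : ℤ[X]) : aeval (rootOf g) h =
    AdjoinRoot.mk (g.map (algebraMap ℤ ℚ)) (h.map (algebraMap ℤ ℚ)) := by
  rw [← AdjoinRoot.aeval_eq, aeval_map_algebraMap]
  rfl

theorem aeval_rootOf_eq_zero_iff {g : ℤ[X]} (hg : g.Monic) (h : ℤ[X]) :
    aeval (rootOf g) h = 0 ↔ g ∣ h := by
  rw [aeval_rootOf, AdjoinRoot.mk_eq_zero]
  exact map_dvd_map _ (algebraMap ℤ ℚ).injective_int hg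

/-- Dedekind's criterion, in Uchida's form. -/
theorem polyIndex_eq_one_iff {g : ℤ[X]} (hg : g.Monic)
    (hirr : Irreducible (g.map (algebraMap ℤ ℚ))) :
    polyIndex g = 1 ↔ ∀ p : ℕ, p.Prime → RegularAt p g := by
  have := Fact.mk hirr
  have : CharZero (RootField g) := charZero_of_injective_algebraMap (algebraMap ℚ _).injective
  have hroot := aeval_rootOf_eq_zero_iff hg
  have hiff : polyIndex g = 1 ↔
      ∀ ζ : RootField g, IsIntegral ℤ ζ → ∃ h : ℤ[X], ζ = aeval (rootOf g) h := by
    rw [polyIndex, AddSubgroup.relIndex_eq_one, SetLike.le_def]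
    refine forall_congr' fun ζ => imp_congr Iff.rfl ?_
    change ζ ∈ Algebra.adjoin ℤ {rootOf g} ↔ _
    rw [Algebra.adjoin_singleton_eq_range_aeval]
    exact exists_congr fun _ => eq_comm
  rw [hiff]
  constructor
  · intro h p hp
    have := Fact.mk hp
    exact regularAt_of_forall_integral hroot hg h
  · intro hreg ζ hζ
    obtain ⟨P, rfl⟩ := AdjoinRoot.mk_surjective ζ
    obtain ⟨b, hb0, hb⟩ := IsLocalization.integerNormalization_spec (nonZeroDivisors ℤ) P
    set h := IsLocalization.integerNormalization (nonZeroDivisors ℤ) P with hh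
    have haev : aeval (rootOf g) h = (b : RootField g) * AdjoinRoot.mk _ P := by
      rw [aeval_rootOf, hb, zsmul_eq_mul, map_mul, map_intCast]
    have hb0 := Int.natAbs_ne_zero.2 (nonZeroDivisors.ne_zero hb0)
    rcases Int.natAbs_eq b with hbn | hbn
    · refine exists_aeval_eq_of_nat_mul hroot hg hreg b.natAbs hb0 hζ h ?_
      refine Eq.trans ?_ haev.symm
      conv_rhs => rw [hbn, Int.cast_natCast]
    · refine exists_aeval_eq_of_nat_mul hroot hg hreg b.natAbs hb0 hζ (-h) ?_
      refine Eq.trans ?_ ((map_neg (aeval (rootOf g)) h).trans (congrArg Neg.neg haev)).symm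
      conv_rhs => rw [hbn, Int.cast_neg, Int.cast_natCast, neg_mul, neg_neg]

/-! ### The family and its discriminant factor. -/

/-- The factor `d ^ d + (-1) ^ (d + m) B ^ d m ^ m (d - m) ^ (d - m) A` of the discriminant of
`familyPoly A B d m`. -/
def discFactor (A B : ℤ) (d m : ℕ) : ℤ :=
  (d : ℤ) ^ d + (-1) ^ (d + m) * B ^ d * (m : ℤ) ^ m * ((d : ℤ) - (m : ℤ)) ^ (d - m) * A

theorem familyPoly_monic (A B : ℤ) {d m : ℕ} (hmd : m < d) : (familyPoly A B d m).Monic := by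
  refine monic_X_pow_add (lt_of_le_of_lt ?_ (Nat.cast_lt.2 hmd))
  rw [← natDegree_le_iff_degree_le]
  refine (natDegree_C_mul_le _ _).trans (natDegree_pow_le.trans ?_)
  have : (C B * X + 1 : ℤ[X]).natDegree ≤ 1 := natDegree_linear_le (a := B) (b := 1)
  nlinarith

theorem familyPoly_comp_monic (A B : ℤ) {d m k : ℕ} (hmd : m < d) (hk : 0 < k) :
    ((familyPoly A B d m).comp (X ^ k)).Monic :=
  (familyPoly_monic A B hmd).comp (monic_X_pow k) (by simpa using hk.ne')

theorem familyPoly_comp (A B : ℤ) (d m k : ℕ) : (familyPoly A B d m).comp (X ^ k) =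
    X ^ (k * d) + C A * (C B * X ^ k + 1) ^ m := by
  simp [familyPoly, pow_mul]

theorem modP_comp_X_pow (p j : ℕ) (h : ℤ[X]) :
    modP p (h.comp (X ^ j)) = (modP p h).comp (X ^ j) := by
  simp [Polynomial.map_comp]

/-! ### Regularity of `f(x^k)` at a single prime. -/

section Local

variable {A B : ℤ} {d m k p : ℕ} [hp : Fact p.Prime]

/-- The only point above `p` that contains `f(x^k)` is `(p, x)`. There `x^(kd)` already lies in the
square since `kd ≥ 2`, and `B x^k + 1` is a unit at that point, so `A` alone decides. -/
theorem regularAt_familyPoly_of_dvd_coeff (hm : 0 < m) (hmd : m < d) (hk : 0 < k)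
    (hpA : (p : ℤ) ∣ A) :
    RegularAt p ((familyPoly A B d m).comp (X ^ k)) ↔ ¬ (p : ℤ) * p ∣ A := by
  have hkd : 2 ≤ k * d := by nlinarith
  rw [familyPoly_comp]
  constructor
  · rintro hreg ⟨r, rfl⟩
    refine hreg X (by simpa using irreducible_X) ?_
    refine add_mem (Ideal.pow_le_pow_right hkd (Ideal.pow_mem_pow self_mem_pointIdeal _)) ?_
    refine Ideal.mul_mem_right _ _ ?_
    rw [C_mul, C_mul, pow_two]
    exact Ideal.mul_mem_right _ _ (Ideal.mul_mem_mul C_mem_pointIdeal C_mem_pointIdeal)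
  · intro hA φ hφ hmem
    obtain ⟨a, rfl⟩ := hpA
    have hprime := pointIdeal_isPrime hφ
    have hXk : X ^ (k * d) ∈ pointIdeal p φ := by
      refine ((Ideal.add_mem_iff_left _ ?_).1 (Ideal.pow_le_self two_ne_zero hmem))
      rw [C_mul, mul_assoc]
      exact Ideal.mul_mem_right _ _ C_mem_pointIdeal
    have hX : X ∈ pointIdeal p φ := hprime.mem_of_pow_mem _ hXk
    have h1 := (Ideal.add_mem_iff_right _
      (Ideal.pow_le_pow_right hkd (Ideal.pow_mem_pow hX _))).1 hmem
    rw [C_mul, mul_assoc, C_mul_mem_pointIdeal_sq_iff hφ] at h1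
    rcases hprime.mem_or_mem h1 with h2 | h2
    · exact hA (mul_dvd_mul_left _ ((C_mem_pointIdeal_iff hφ a).1 h2))
    · refine hprime.ne_top ((Ideal.eq_top_iff_one _).2 ?_)
      exact (Ideal.add_mem_iff_right _ (Ideal.mul_mem_left _ _
        (Ideal.pow_mem_of_mem _ hX _ hk))).1 (hprime.mem_of_pow_mem _ h2)

/-- By Frobenius, `t(x)^p ≡ t(x^p)` mod `p`. The integrality in the second condition is therefore
automatic, and only coprimality has content. -/
theorem exists_C_mul_eq_frobenius_defect (p : ℕ) [hp : Fact p.Prime] (A B : ℤ) (m : ℕ) :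
    ∃ q : ℤ[X], C (p : ℤ) * q =
      (-(C A * (C B * X + 1) ^ m)) ^ p + C A * (C B * X ^ p + 1) ^ m := by
  have h0 : modP p ((-(C A * (C B * X + 1) ^ m)) ^ p + C A * (C B * X ^ p + 1) ^ m) = 0 := by
    rw [map_add, map_pow, coe_mapRingHom, ← ZMod.expand_card]
    simp
  obtain ⟨q, hq⟩ := (modP_eq_zero_iff _).1 h0
  exact ⟨q, hq.symm⟩

theorem regularAt_familyPoly_of_dvd_exponent (hmd : m < d) (hk : 0 < k) (hpk : p ∣ k) :
    RegularAt p ((familyPoly A B d m).comp (X ^ k)) ↔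
      DivCoprimeMod p ((-(C A * (C B * X + 1) ^ m)) ^ p + C A * (C B * X ^ p + 1) ^ m)
        (familyPoly A B d m) := by
  obtain ⟨j, rfl⟩ := hpk
  have hj : 0 < j := Nat.pos_of_mul_pos_left hk
  obtain ⟨q, hq⟩ := exists_C_mul_eq_frobenius_defect p A B m
  set f := familyPoly A B d m with hf
  set t : ℤ[X] := -(C A * (C B * X + 1) ^ m) with ht
  set F := f.comp (X ^ j) with hF
  set Q := q.comp (X ^ j) with hQ
  -- Since `x^d = t + f`, expanding `x^(dp) = (t + f)^p` to second order in `f` and substituting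
  -- `x^j` gives this. At a point containing `F`, the last two terms lie in the square, so only `p
  -- Q` matters.
  have hexp : ∃ w s, f.comp (X ^ (p * j)) = C (p : ℤ) * Q + C (p : ℤ) * w * F + s * F ^ 2 := by
    obtain ⟨s, hs⟩ := powAddExpansion t f p
    have hXd : t + f = X ^ d := by
      rw [hf, ht, familyPoly]
      ring
    have h1 : f.comp (X ^ p) = C (p : ℤ) * q + C (p : ℤ) * t ^ (p - 1) * f + s * f ^ 2 := by
      rw [hq, hf, familyPoly_comp, ← hf, mul_comm p d, pow_mul, ← hXd, hs]
      simp only [eq_intCast, Int.cast_natCast]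
      ring
    refine ⟨(t ^ (p - 1)).comp (X ^ j), s.comp (X ^ j), ?_⟩
    have h2 := congrArg (fun h => h.comp (X ^ j)) h1
    simp only [comp_assoc, X_pow_comp, ← pow_mul, add_comp, mul_comp, C_comp] at h2
    rw [mul_comm p j, h2, hF, hQ, pow_comp f]
  have hfrob : modP p (f.comp (X ^ (p * j))) = modP p F ^ p := by
    have h1 : f.comp (X ^ (p * j)) = F.comp (X ^ p) := by
      rw [hF, comp_assoc, X_pow_comp, ← pow_mul]
    rw [h1, modP_comp_X_pow, ← expand_eq_comp_X_pow, ZMod.expand_card]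
  have hsq {φ : ℤ[X]} (hφ : Irreducible (modP p φ)) (hFM : F ∈ pointIdeal p φ) :
      f.comp (X ^ (p * j)) ∈ pointIdeal p φ ^ 2 ↔ Q ∈ pointIdeal p φ := by
    obtain ⟨w, s, hws⟩ := hexp
    rw [hws, ← C_mul_mem_pointIdeal_sq_iff hφ, add_assoc]
    refine Ideal.add_mem_iff_left _ (add_mem ?_ ?_)
    · rw [pow_two]
      exact Ideal.mul_mem_mul (Ideal.mul_mem_right _ _ C_mem_pointIdeal) hFM
    · exact Ideal.mul_mem_left _ _ (Ideal.pow_mem_pow hFM 2)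
  constructor
  · intro hreg
    refine ⟨q, hq, ?_⟩
    have hf0 : modP p f ≠ 0 := ((familyPoly_monic A B hmd).map _).ne_zero
    refine isCoprime_of_irreducible_dvd (fun h => hf0 h.2) fun z hz hzq hzf => ?_
    -- A common factor `z` of `q` and `f` gives a common factor `z(x^j)` of `Q` and `F`, nonconstant
    -- because `j > 0`; any irreducible factor of it is a bad point.
    have hzj : (z.comp (X ^ j)).natDegree ≠ 0 := by
      rw [natDegree_comp, natDegree_X_pow]
      exact mul_ne_zero hz.natDegree_pos.ne' hj.ne'
    obtain ⟨φ, hφ, hφz⟩ := exists_irreducible_modP_dvd (p := p) (h := z.comp (X ^ j))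
      (fun h => hzj (by rw [h, natDegree_zero]))
      (fun h => hzj (natDegree_eq_zero_of_isUnit h))
    have hmem (h : ℤ[X]) (hh : z ∣ modP p h) : h.comp (X ^ j) ∈ pointIdeal p φ := by
      rw [mem_pointIdeal_iff, modP_comp_X_pow]
      obtain ⟨c, hc⟩ := hh
      rw [hc, mul_comp]
      exact hφz.mul_right _
    exact hreg φ hφ ((hsq hφ (hmem f hzf)).2 (hmem q hzq))
  · rintro ⟨q', hq', hcop⟩ φ hφ hmem
    have hp0 : (C (p : ℤ) : ℤ[X]) ≠ 0 := by simpa using hp.out.ne_zero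
    obtain rfl : q' = q := mul_left_cancel₀ hp0 (hq'.trans hq.symm)
    have hFM : F ∈ pointIdeal p φ := by
      have := (mem_pointIdeal_iff _).1 (Ideal.pow_le_self two_ne_zero hmem)
      rw [hfrob] at this
      exact (mem_pointIdeal_iff _).2 (hφ.prime.dvd_of_dvd_pow this)
    have hQM := (hsq hφ hFM).1 hmem
    rw [mem_pointIdeal_iff, modP_comp_X_pow] at hFM hQM
    have := hcop.map (compRingHom (X ^ j : (ZMod p)[X]))
    exact hφ.not_isUnit (this.isUnit_of_dvd' hQM hFM)

theorem natCast_dvd_pow_iff {a : ℤ} {n : ℕ} (hn : n ≠ 0) : (p : ℤ) ∣ a ^ n ↔ (p : ℤ) ∣ a :=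
  (Nat.prime_iff_prime_int.1 hp.out).dvd_pow_iff_dvd hn

theorem not_dvd_of_dvd_degree (hgcd : Int.gcd (d : ℤ) ((m : ℤ) * B) = 1) (hpd : (p : ℤ) ∣ d) :
    ¬ (p : ℤ) ∣ m ∧ ¬ (p : ℤ) ∣ B ∧ ¬ (p : ℤ) ∣ (d : ℤ) - m := by
  have hpI := Nat.prime_iff_prime_int.1 hp.out
  have key : ¬ (p : ℤ) ∣ m * B := fun h =>
    hpI.not_isUnit ((Int.isCoprime_iff_gcd_eq_one.2 hgcd).isUnit_of_dvd' hpd h)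
  refine ⟨fun h => key (h.mul_right _), fun h => key (h.mul_left _), fun h => key ?_⟩
  exact ((dvd_sub_right hpd).1 h).mul_right _

theorem not_dvd_of_dvd_discFactor_of_not_dvd_degree (hmd : m < d)
    (hD : (p : ℤ) ∣ discFactor A B d m) (hpd : ¬ (p : ℤ) ∣ d) :
    ¬ (p : ℤ) ∣ ((d : ℤ) - m) * B := by
  have hd0 : d ≠ 0 := by omega
  intro h
  refine hpd ((natCast_dvd_pow_iff hd0).1 ((dvd_add_left ?_).1 hD))
  rcases (Nat.prime_iff_prime_int.1 hp.out).dvd_or_dvd h with h | h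
  · exact (((natCast_dvd_pow_iff (by omega : d - m ≠ 0)).2 h).mul_left _).mul_right _
  · exact (((((natCast_dvd_pow_iff hd0).2 h).mul_left _).mul_right _).mul_right _).mul_right _

/-- `p ^ n` divides `d ^ d`, hence also the other summand, in which `gcd(d, mB) = 1` makes every
factor except `A` prime to `p`. -/
theorem pow_dvd_coeff_of_dvd_degree (n : ℕ) (hn : n ≤ d)
    (hgcd : Int.gcd (d : ℤ) ((m : ℤ) * B) = 1) (hpd : (p : ℤ) ∣ d)
    (hD : (p : ℤ) ^ n ∣ discFactor A B d m) : (p : ℤ) ^ n ∣ A := by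
  have hpI := Nat.prime_iff_prime_int.1 hp.out
  obtain ⟨h1, h2, h3⟩ := not_dvd_of_dvd_degree hgcd hpd
  have h4 : (p : ℤ) ^ n ∣ (d : ℤ) ^ d := (pow_dvd_pow _ hn).trans (pow_dvd_pow_of_dvd hpd d)
  have h5 := (dvd_add_right h4).1 hD
  have cop {x : ℤ} (hx : ¬ (p : ℤ) ∣ x) : IsCoprime ((p : ℤ) ^ n) x :=
    ((hpI.coprime_iff_not_dvd).2 hx).pow_left
  refine IsCoprime.dvd_of_dvd_mul_left ?_ h5
  refine IsCoprime.mul_right (IsCoprime.mul_right (IsCoprime.mul_right ?_ ?_) ?_) ?_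
  · exact cop fun h => hpI.not_isUnit (isUnit_of_dvd_unit h (isUnit_neg_one.pow _))
  all_goals exact (cop ‹_›).pow_right

theorem exists_linear_root_modulo {e : ℤ} (d : ℤ) (n : ℕ) (he : ¬ (p : ℤ) ∣ e) :
    ∃ b : ℤ, (p : ℤ) ^ n ∣ e * b + d := by
  obtain ⟨u, v, huv⟩ :=
    (((Nat.prime_iff_prime_int.1 hp.out).coprime_iff_not_dvd).2 he).pow_left (m := n)
  exact ⟨-d * v, d * u, by linear_combination -d * huv⟩

/-- Evaluation of `familyPoly` at a root `b` of `(d - m) B x + d` modulo `N`. -/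
theorem dvd_pow_mul_eval_familyPoly_sub (hmd : m < d) {N b : ℤ}
    (hb : N ∣ ((d : ℤ) - m) * B * b + d) :
    N ∣ (((d : ℤ) - m) * B) ^ d * (familyPoly A B d m).eval b - (-1) ^ d * discFactor A B d m := by
  obtain ⟨c, hc⟩ := hb
  -- Modulo `N`, `(d - m)Bb ≡ -d`, hence `(d - m)(Bb + 1) ≡ -m`.
  have h1 : N ∣ (((d : ℤ) - m) * B * b) ^ d - (-d : ℤ) ^ d :=
    Dvd.dvd.trans ⟨c, by linear_combination hc⟩ (sub_dvd_pow_sub_pow _ _ d)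
  have h2 : N ∣ (((d : ℤ) - m) * (B * b + 1)) ^ m - (-m : ℤ) ^ m :=
    Dvd.dvd.trans ⟨c, by linear_combination hc⟩ (sub_dvd_pow_sub_pow _ _ m)
  have h3 : ((d : ℤ) - m) ^ d = ((d : ℤ) - m) ^ (d - m) * ((d : ℤ) - m) ^ m := by
    rw [← pow_add, Nat.sub_add_cancel hmd.le]
  have h4 : (-1 : ℤ) ^ d * (-1) ^ (d + m) = (-1) ^ m := by
    rw [pow_add, ← mul_assoc, ← mul_pow]
    simp
  have h5 : (((d : ℤ) - m) * B) ^ d * (familyPoly A B d m).eval b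
        - (-1) ^ d * discFactor A B d m =
      ((((d : ℤ) - m) * B * b) ^ d - (-d : ℤ) ^ d) + A * B ^ d * ((d : ℤ) - m) ^ (d - m) *
        ((((d : ℤ) - m) * (B * b + 1)) ^ m - (-m : ℤ) ^ m) := by
    simp only [familyPoly, discFactor, eval_add, eval_pow, eval_mul, eval_X, eval_C, eval_one]
    rw [neg_pow (d : ℤ) d, neg_pow (m : ℤ) m, ← h4, mul_pow _ (B * b + 1), mul_pow _ b,
      mul_pow _ B, h3]
    ring
  rw [h5]
  exact dvd_add h1 (h2.mul_left _)

/-- This reads `x f' = d f - A(Bx + 1)^(m-1) ((d - m)Bx + d)`, isolating the linear factor on which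
double roots must lie. -/
theorem familyPoly_derivative_identity {R : Type*} [CommRing R] (A B x : R) {d m : ℕ} (hm : 0 < m)
    (hd : 0 < d) :
    x * (d * x ^ (d - 1) + m * A * B * (B * x + 1) ^ (m - 1)) =
      d * (x ^ d + A * (B * x + 1) ^ m) - A * (B * x + 1) ^ (m - 1) * ((d - m) * B * x + d) := by
  obtain ⟨m, rfl⟩ := Nat.exists_eq_succ_of_ne_zero hm.ne'
  obtain ⟨d, rfl⟩ := Nat.exists_eq_succ_of_ne_zero hd.ne'
  simp only [Nat.succ_eq_add_one, Nat.add_sub_cancel, pow_succ]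
  push_cast
  ring

theorem derivative_familyPoly (A B : ℤ) (d m : ℕ) : derivative (familyPoly A B d m) =
    C (d : ℤ) * X ^ (d - 1) + C (m : ℤ) * C A * C B * (C B * X + 1) ^ (m - 1) := by
  simp [familyPoly, derivative_pow]
  ring

theorem exists_taylor_comp (f h : ℤ[X]) (b : ℤ) : ∃ c, f.comp h =
    C (f.eval b) + C ((derivative f).eval b) * (h - C b) + c * (h - C b) ^ 2 := by
  obtain ⟨c, hc⟩ := binomExpansion (f.map C) (C b) (h - C b)
  refine ⟨c, ?_⟩
  rw [add_sub_cancel, derivative_map, eval_map, eval_map, eval_map, eval₂_at_apply,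
    eval₂_at_apply] at hc
  exact hc

/-- With `b` the root of the linear factor mod `p²`, `p² ∣ f(b)` and `p ∣ f'(b)`. The Taylor
expansion at `b` then puts `f(x^k)` in `M ^ 2` for any point `M` containing `x^k - b`; whether `p ∣
k` plays no role. -/
theorem not_regularAt_of_sq_dvd_discFactor (hm : 0 < m) (hmd : m < d) (hk : 0 < k)
    (hgcd : Int.gcd (d : ℤ) ((m : ℤ) * B) = 1) (hpA : ¬ (p : ℤ) ∣ A)
    (hD : (p : ℤ) * p ∣ discFactor A B d m) :
    ¬ RegularAt p ((familyPoly A B d m).comp (X ^ k)) := by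
  have hpI := Nat.prime_iff_prime_int.1 hp.out
  have hpD : (p : ℤ) ∣ discFactor A B d m := (dvd_mul_right _ _).trans hD
  have hpd : ¬ (p : ℤ) ∣ d := fun h => hpA (by
    simpa using pow_dvd_coeff_of_dvd_degree 1 (by omega) hgcd h (by simpa using hpD))
  have he := not_dvd_of_dvd_discFactor_of_not_dvd_degree hmd hpD hpd
  obtain ⟨b, hb⟩ := exists_linear_root_modulo (d : ℤ) 2 he
  rw [pow_two] at hb
  have hfb : (p : ℤ) * p ∣ (familyPoly A B d m).eval b := by
    have h1 := (dvd_sub_left (hD.mul_left _)).1 (dvd_pow_mul_eval_familyPoly_sub (A := A) hmd hb)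
    have cop := ((hpI.coprime_iff_not_dvd).2 he).pow_right (n := d)
    exact (cop.mul_left cop).dvd_of_dvd_mul_left h1
  have hpb : (p : ℤ) ∣ ((d : ℤ) - m) * B * b + d := (dvd_mul_right _ _).trans hb
  have hf'b : (p : ℤ) ∣ (derivative (familyPoly A B d m)).eval b := by
    have h1 := familyPoly_derivative_identity A B b hm (hm.trans hmd)
    have h2 : (p : ℤ) ∣ b * (derivative (familyPoly A B d m)).eval b := by
      rw [derivative_familyPoly]
      simp only [eval_add, eval_mul, eval_pow, eval_X, eval_C, eval_one]
      rw [h1]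
      refine dvd_sub (Dvd.dvd.mul_left ?_ _) (hpb.mul_left _)
      refine ((dvd_mul_right _ _).trans hfb).trans ?_
      simp [familyPoly]
    refine (hpI.dvd_or_dvd h2).resolve_left fun h => hpd ?_
    exact (dvd_add_right (h.mul_left _)).1 hpb
  intro hreg
  have hmon : (X ^ k - C (b : ZMod p) : (ZMod p)[X]).Monic := monic_X_pow_sub_C _ hk.ne'
  obtain ⟨φ, hφ, hdvd⟩ := exists_irreducible_modP_dvd hmon.ne_zero (fun h => by
    have := natDegree_eq_zero_of_isUnit h
    rw [natDegree_X_pow_sub_C] at this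
    omega)
  have hmem : X ^ k - C b ∈ pointIdeal p φ := by
    rw [mem_pointIdeal_iff]
    simpa using hdvd
  obtain ⟨c, hc⟩ := exists_taylor_comp (familyPoly A B d m) (X ^ k) b
  refine hreg φ hφ ?_
  rw [hc]
  refine add_mem (add_mem ?_ ?_) (Ideal.mul_mem_left _ _ (Ideal.pow_mem_pow hmem 2))
  · exact (C_mem_pointIdeal_sq_iff hφ _).2 hfb
  · rw [pow_two]
    exact Ideal.mul_mem_mul ((C_mem_pointIdeal_iff hφ _).2 hf'b) hmem

/-- A double root of `familyPoly` in a domain where `A ≠ 0` is the root of `(d - m) B x + d`. -/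
theorem double_root_familyPoly {R : Type*} [CommRing R] [IsDomain R] {A B x : R} {d m : ℕ}
    (hm : 0 < m) (hmd : m < d) (hA : A ≠ 0) (h0 : x ^ d + A * (B * x + 1) ^ m = 0)
    (h1 : (d : R) * x ^ (d - 1) + m * A * B * (B * x + 1) ^ (m - 1) = 0) :
    (d - m) * B * x + d = 0 := by
  have hd : 0 < d := hm.trans hmd
  have hB : B * x + 1 ≠ 0 := by
    intro h
    rw [h, zero_pow hm.ne', mul_zero, add_zero] at h0
    rw [pow_eq_zero_iff hd.ne'] at h0
    simp [h0] at h
  have h2 := familyPoly_derivative_identity A B x hm hd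
  rw [h0, h1, mul_zero, mul_zero, zero_sub, zero_eq_neg] at h2
  exact (mul_eq_zero.1 h2).resolve_left (mul_ne_zero hA (pow_ne_zero _ hB))

/-- A singular point makes the image `β` of `x^k` a double root of `f` in the residue domain, so `β`
is the image of the integer `b`. In the Taylor expansion at `b` all terms but `f(b)` lie in the
square, so `p² ∣ f(b)` and hence `p²` divides the discriminant factor. -/
theorem regularAt_of_not_sq_dvd_discFactor (hm : 0 < m) (hmd : m < d) (hk : 0 < k)
    (hgcd : Int.gcd (d : ℤ) ((m : ℤ) * B) = 1) (hpA : ¬ (p : ℤ) ∣ A) (hpk : ¬ p ∣ k)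
    (hD : ¬ (p : ℤ) * p ∣ discFactor A B d m) :
    RegularAt p ((familyPoly A B d m).comp (X ^ k)) := by
  intro φ hφ hmem
  have hpI := Nat.prime_iff_prime_int.1 hp.out
  have hd : 0 < d := hm.trans hmd
  have hprime := pointIdeal_isPrime hφ
  let π := Ideal.Quotient.mk (pointIdeal p φ)
  have hπ (h : ℤ[X]) : π h = 0 ↔ h ∈ pointIdeal p φ := Ideal.Quotient.eq_zero_iff_mem
  have hcast (n : ℤ) : π (C n) = 0 ↔ (p : ℤ) ∣ n := (hπ _).trans (C_mem_pointIdeal_iff hφ n)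
  have hnat (n : ℕ) : (n : ℤ[X] ⧸ pointIdeal p φ) = π (C (n : ℤ)) := by simp
  set β := π (X ^ k) with hβ
  have hf : β ^ d + π (C A) * (π (C B) * β + 1) ^ m = 0 := by
    have := (hπ _).2 (Ideal.pow_le_self two_ne_zero hmem)
    rw [familyPoly_comp, pow_mul] at this
    simpa only [hβ, map_add, map_mul, map_pow, map_one] using this
  have hβ0 : β ≠ 0 := by
    intro h
    rw [h, zero_pow hd.ne', mul_zero, zero_add, zero_add, one_pow, mul_one, hcast] at hf
    exact hpA hf
  have hf' : (d : ℤ[X] ⧸ pointIdeal p φ) * β ^ (d - 1) +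
      m * π (C A) * π (C B) * (π (C B) * β + 1) ^ (m - 1) = 0 := by
    have h1 := (hπ _).2 (derivative_mem_pointIdeal hmem)
    rw [derivative_comp, derivative_X_pow, map_mul, derivative_familyPoly] at h1
    simp only [add_comp, mul_comp, pow_comp, C_comp, X_comp, one_comp, map_add, map_mul, map_pow,
      map_one] at h1
    rw [← map_pow π X k, ← hβ, ← hnat, ← hnat, ← hnat] at h1
    -- The chain-rule factor `k x^(k-1)` is nonzero at the point because `p ∤ k` and `β ≠ 0`.
    refine (mul_eq_zero.1 h1).resolve_left (mul_ne_zero ?_ ?_)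
    · rw [hnat, Ne, hcast, Int.natCast_dvd_natCast]
      exact hpk
    · refine pow_ne_zero _ fun h => hβ0 ?_
      rw [hβ, map_pow, h, zero_pow hk.ne']
  have hroot := double_root_familyPoly hm hmd (mt (hcast A).1 hpA) hf hf'
  have hlin : π (C (((d : ℤ) - m) * B)) * β + π (C (d : ℤ)) = 0 := by
    rw [← hroot]
    simp
  have he : ¬ (p : ℤ) ∣ ((d : ℤ) - m) * B := by
    intro h
    rw [(hcast _).2 h, zero_mul, zero_add, hcast] at hlin
    obtain ⟨-, h1, h2⟩ := not_dvd_of_dvd_degree hgcd hlin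
    exact (hpI.dvd_or_dvd h).elim h2 h1
  -- The root is taken mod `p²`, although `β` determines it only mod `p`: comparing `f(b)` with the
  -- discriminant factor needs the finer congruence.
  obtain ⟨b, hb⟩ := exists_linear_root_modulo (d : ℤ) 2 he
  rw [pow_two] at hb
  have hβb : β = π (C b) := by
    have h1 := (hcast _).2 ((dvd_mul_right _ _).trans hb)
    rw [C_add, C_mul, map_add, map_mul] at h1
    exact mul_left_cancel₀ (mt (hcast _).1 he) (add_right_cancel (hlin.trans h1.symm))
  have hXb : X ^ k - C b ∈ pointIdeal p φ := by
    rw [← hπ, map_sub, ← hβb, sub_self]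
  have hf'b : C ((derivative (familyPoly A B d m)).eval b) ∈ pointIdeal p φ := by
    rw [← hπ, ← hf', hβb, derivative_familyPoly]
    simp
  obtain ⟨c, hc⟩ := exists_taylor_comp (familyPoly A B d m) (X ^ k) b
  rw [hc, add_assoc] at hmem
  have hfb := (Ideal.add_mem_iff_left _ (add_mem (by
    rw [pow_two]
    exact Ideal.mul_mem_mul hf'b hXb)
    (Ideal.mul_mem_left _ c (Ideal.pow_mem_pow hXb 2)))).1 hmem
  rw [C_mem_pointIdeal_sq_iff hφ] at hfb
  have h1 := (dvd_sub_right (hfb.mul_left _)).1 (dvd_pow_mul_eval_familyPoly_sub (A := A) hmd hb)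
  exact hD ((isUnit_neg_one.pow d).dvd_mul_left.1 h1)

end Local

/-! ### Assembling the local tests. -/

theorem Int.squarefree_iff_prime_squarefree {n : ℤ} :
    Squarefree n ↔ ∀ p : ℕ, p.Prime → ¬ (p : ℤ) * p ∣ n := by
  rw [← Int.squarefree_natAbs, Nat.squarefree_iff_prime_squarefree]
  refine forall₂_congr fun p _ => not_congr ?_
  rw [← Int.natCast_dvd, Nat.cast_mul]

theorem isMonogenicPoly_familyPoly_comp_iff {A B : ℤ} {d m k : ℕ} (hm : 0 < m) (hmd : m < d)
    (hgcd : Int.gcd (d : ℤ) ((m : ℤ) * B) = 1) (hk : 0 < k)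
    (hirr : Irreducible (((familyPoly A B d m).comp (X ^ k)).map (algebraMap ℤ ℚ))) :
    IsMonogenicPoly ((familyPoly A B d m).comp (X ^ k)) ↔
      (Squarefree A ∧ Squarefree (discFactor A B d m)) ∧
      ∀ p : ℕ, p.Prime → p ∣ k →
        DivCoprimeMod p
          ((-(C A * (C B * X + 1) ^ m)) ^ p + C A * (C B * X ^ p + 1) ^ m)
          (familyPoly A B d m) := by
  have hmon := familyPoly_comp_monic A B hmd hk
  have hiff : IsMonogenicPoly ((familyPoly A B d m).comp (X ^ k)) ↔
      ∀ p : ℕ, p.Prime → RegularAt p ((familyPoly A B d m).comp (X ^ k)) := by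
    rw [← polyIndex_eq_one_iff hmon hirr]
    exact ⟨fun h => h.2.2, fun h => ⟨hmon, hirr, h⟩⟩
  rw [hiff, Int.squarefree_iff_prime_squarefree, Int.squarefree_iff_prime_squarefree]
  constructor
  · intro hreg
    have hA (p : ℕ) (hp : p.Prime) : ¬ (p : ℤ) * p ∣ A := by
      have := Fact.mk hp
      intro h
      have hpA : (p : ℤ) ∣ A := (dvd_mul_right _ _).trans h
      exact (regularAt_familyPoly_of_dvd_coeff hm hmd hk hpA).1 (hreg p hp) h
    refine ⟨⟨hA, fun p hp hD => ?_⟩, fun p hp hpk => ?_⟩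
    · have := Fact.mk hp
      -- If `p` divides both `A` and the discriminant factor, it divides `d`; then `p²` dividing the
      -- factor forces `p² ∣ A`, already excluded.
      by_cases hpA : (p : ℤ) ∣ A
      · have hpd : (p : ℤ) ∣ d := by
          refine (natCast_dvd_pow_iff (by omega : d ≠ 0)).1
            ((dvd_add_left ?_).1 ((dvd_mul_right _ _).trans hD))
          exact hpA.mul_left _
        rw [← pow_two] at hD
        refine hA p hp ?_
        rw [← pow_two]
        exact pow_dvd_coeff_of_dvd_degree 2 (by omega) hgcd hpd hD
      · exact not_regularAt_of_sq_dvd_discFactor hm hmd hk hgcd hpA hD (hreg p hp)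
    · have := Fact.mk hp
      exact (regularAt_familyPoly_of_dvd_exponent hmd hk hpk).1 (hreg p hp)
  · rintro ⟨⟨hA, hD⟩, hdc⟩ p hp
    have := Fact.mk hp
    by_cases hpk : p ∣ k
    · exact (regularAt_familyPoly_of_dvd_exponent hmd hk hpk).2 (hdc p hp hpk)
    by_cases hpA : (p : ℤ) ∣ A
    · exact (regularAt_familyPoly_of_dvd_coeff hm hmd hk hpA).2 (hA p hp)
    · exact regularAt_of_not_sq_dvd_discFactor hm hmd hk hgcd hpA hpk (hD p hp)

theorem proposition4p5 (A B : ℤ) (d m k : ℕ) (hm : 0 < m) (hmd : m < d)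
    (hgcd : Int.gcd (d : ℤ) ((m : ℤ) * B) = 1) (hk : 0 < k)
    (hirr : Irreducible (((familyPoly A B d m).comp (X ^ k)).map (algebraMap ℤ ℚ))) :
    (IsMonogenicPoly ((familyPoly A B d m).comp (X ^ k)) ↔
      (Squarefree A ∧
        Squarefree ((d : ℤ) ^ d +
          (-1) ^ (d + m) * B ^ d * (m : ℤ) ^ m * ((d : ℤ) - (m : ℤ)) ^ (d - m) * A)) ∧
      ∀ p : ℕ, p.Prime → p ∣ k →
        DivCoprimeMod p
          ((-(C A * (C B * X + 1) ^ m)) ^ p + C A * (C B * X ^ p + 1) ^ m)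
          (familyPoly A B d m)) ∧
    (UniqueFactorizationMonoid.radical k ∣ UniqueFactorizationMonoid.radical A.natAbs →
      (IsMonogenicPoly ((familyPoly A B d m).comp (X ^ k)) ↔
        Squarefree A ∧
        Squarefree ((d : ℤ) ^ d +
          (-1) ^ (d + m) * B ^ d * (m : ℤ) ^ m * ((d : ℤ) - (m : ℤ)) ^ (d - m) * A))) := by
  have hmain := isMonogenicPoly_familyPoly_comp_iff hm hmd hgcd hk hirr
  refine ⟨hmain, fun hrad => hmain.trans (and_iff_left_of_imp ?_)⟩
  rintro ⟨hA, -⟩ p hp hpk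
  have := Fact.mk hp
  have hpA : (p : ℤ) ∣ A := by
    rw [Int.natCast_dvd]
    refine dvd_trans ?_ (hrad.trans UniqueFactorizationMonoid.radical_dvd_self)
    exact (UniqueFactorizationMonoid.dvd_radical_iff_of_irreducible hp hk.ne').2 hpk
  -- As `p` divides both `k` and `A`, both tests describe the same regularity, so coprimality
  -- becomes `p² ∤ A`.
  rw [← regularAt_familyPoly_of_dvd_exponent hmd hk hpk,
    regularAt_familyPoly_of_dvd_coeff hm hmd hk hpA]
  exact Int.squarefree_iff_prime_squarefree.1 hA p hp
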